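/- Consider nondegenerate triangles in the Euclidean plane, with side lengths $a,b,c$, semi-perimeter $p=(a+b+c)/2$, circumradius $R$ and inradius $r$. Let $x_0\approx 4.113537611$ be the largest real root of $x^3-5x^2+15=0$, and put $$f(x)=\frac{\ln\left[-\dfrac{2(x^3-5x^2+15)}{x^2-3}\right]}{\ln\left[\dfrac{24(x^2-3)}{(x^2+3)^2}\right]}\qquad(3<x<x_0).$$ Then $f$ is differentiable on $(3,x_0)$, the equation $f'(x)=0$ has exactly one root $x_1$ in $(3,x_0)$, and $x_1\approx 3.067873979$, $f(x_1)\approx 5.977929015$ (all three approximations are correct to within $5\cdot 10^{-10}$). For every real $\lambda\le f(x_1)$ and every triangle, $$\sqrt3\,p\ \ge\ 10r-r\left(\frac{2r}{R}\right)^{\lambda},$$ with equality if and only if either $a:b:c=1:1:1$, or $\lambda=f(x_1)$ and, for a suitable labelling of the sides, $a:b:c=2(x_1^2-3):(x_1^2+3):(x_1^2+3)$. The bound on $\lambda$ is best possible: for every real $\lambda>f(x_1)$ there is a triangle for which the inequality fails. In particular $5<f(x_1)$, so that $\sqrt3\,p\ge 10r-r(2r/R)^5$ holds for every triangle (Liu's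 conjecture). -/

import Mathlib

open Set

noncomputable section

namespace EdwardsChild

/-- Nondegenerate triangles in the Euclidean plane. -/
abbrev Tri : Type := Affine.Triangle ℝ (EuclideanSpace ℝ (Fin 2))

/-- The semi-perimeter of a triangle. -/
def semiperimeter (T : Tri) : ℝ :=
  (dist (T.points 1) (T.points 2) + dist (T.points 2) (T.points 0)
    + dist (T.points 0) (T.points 1)) / 2

/-- The side lengths, in a suitable labelling of the vertices, satisfy `a : b : c = u : v : w`
(`a` is the side opposite to the first vertex, and so on). -/
def HasSideRatio (T : Tri) (u v w : ℝ) : Prop :=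
  ∃ σ : Equiv.Perm (Fin 3), ∃ k : ℝ, 0 < k ∧
    dist (T.points (σ 1)) (T.points (σ 2)) = k * u ∧
    dist (T.points (σ 2)) (T.points (σ 0)) = k * v ∧
    dist (T.points (σ 0)) (T.points (σ 1)) = k * w

/-- The right-hand side `10 r - r (2 r / R) ^ l`, with `r` the inradius, `R` the circumradius
and a real exponent `l`. -/
def lowerBound (T : Tri) (l : ℝ) : ℝ :=
  10 * T.inradius - T.inradius * (2 * T.inradius / T.circumradius) ^ l

/-- The function `f`; only its values on `(3, x₀)` matter, where both logarithms have positive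
arguments and the denominator is nonzero. -/
def f (x : ℝ) : ℝ :=
  Real.log (-(2 * (x ^ 3 - 5 * x ^ 2 + 15) / (x ^ 2 - 3))) /
    Real.log (24 * (x ^ 2 - 3) / (x ^ 2 + 3) ^ 2)

end EdwardsChild

end

noncomputable section

namespace EdwardsChild

/-! Measure the tangent lengths `u`, `v`, `w` from the vertices to the incircle in units of `r`.
They are the roots of a cubic whose coefficients depend only on `p / r` and `R / r`. For fixed `R /
r` its discriminant is a concave quadratic in `(p / r) ^ 2`, and its zeros belong to the two
isosceles triangles with that ratio. Nonnegativity of the discriminant therefore makes one isosceles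
triangle the minimiser of `p` (`fundamental_inequality`, `isosceles_ratio`,
`exists_isosceles_comparison`).

The minimisers are the triangles with sides `2(x² - 3), x² + 3, x² + 3`, `x ≥ 3`. For them `√3 p / r
= 2x³ / (x² - 3)` and `2r / R = 24(x² - 3) / (x² + 3)²`. The claim becomes `10 - 2x³ / (x² - 3) ≤
(2r / R) ^ l`. The left side is nonpositive for `x ≥ x₀`; for `3 < x < x₀` logarithms turn the claim
into `l ≤ f x`. So the best exponent is the minimum of `f`.

Write `f = N / D` and `q = N' / D'`. Since `D' < 0`, `f'` has the sign of `critical = N - q D`,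
whose derivative `-q' D` has the sign of a quartic. Hence `critical` starts at `0` for `x = 3`,
decreases, then increases, and vanishes once more, at `x₁`. There `f x₁ = q x₁`, a rational
expression, so an enclosure of `x₁` gives one of `f x₁`. -/

/-- The cubic whose largest root is the right end of the domain of `f`. -/
def cubic (x : ℝ) : ℝ := x ^ 3 - 5 * x ^ 2 + 15

/-- The numerator of `f`. -/
def logNum (x : ℝ) : ℝ := Real.log (-(2 * (x ^ 3 - 5 * x ^ 2 + 15) / (x ^ 2 - 3)))

/-- The denominator of `f`. -/
def logDen (x : ℝ) : ℝ := Real.log (24 * (x ^ 2 - 3) / (x ^ 2 + 3) ^ 2)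

/-- The quotient of the derivatives of `logNum` and `logDen`. -/
def derivRatio (x : ℝ) : ℝ := x * (x ^ 2 + 3) / (-(2 * cubic x))

/-- A function with the sign of the derivative of `f`. -/
def critical (x : ℝ) : ℝ := logNum x - derivRatio x * logDen x

/-! ### The largest root of the cubic -/

lemma exists_isGreatest_cubic_root :
    ∃ x₀ : ℝ, IsGreatest {x : ℝ | x ^ 3 - 5 * x ^ 2 + 15 = 0} x₀ ∧
      4.1135376108 < x₀ ∧ x₀ < 4.1135376109 ∧ (∀ x, 3 ≤ x → x < x₀ → cubic x < 0) ∧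
      ∀ x, x₀ ≤ x → 0 ≤ cubic x := by
  have hc : ContinuousOn (fun x : ℝ => x ^ 3 - 5 * x ^ 2 + 15)
      (Icc 4.1135376108 4.1135376109) := by fun_prop
  obtain ⟨x₀, ⟨hl, hr⟩, h0⟩ := intermediate_value_Ioo (by norm_num) hc
    (show (0 : ℝ) ∈ Ioo _ _ by constructor <;> norm_num)
  simp only at h0
  -- The cofactor is `x² + x x₀ + x₀² - 5(x + x₀)`, with the mixed term split in halves so that both
  -- summands are positive once `x ≥ 4` and `x₀ > 4`.
  have hfac : ∀ x, cubic x = (x - x₀) * (x * (x - 5 + x₀ / 2) + x₀ * (x₀ - 5 + x / 2)) := by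
    intro x
    simp only [cubic]
    linear_combination h0
  have hpos : ∀ x, 4 ≤ x → 0 < x * (x - 5 + x₀ / 2) + x₀ * (x₀ - 5 + x / 2) := by
    intro x hx
    have h1 : 0 < x - 5 + x₀ / 2 := by linarith
    have h2 : 0 < x₀ - 5 + x / 2 := by linarith
    have : 0 < x := by linarith
    have : 0 < x₀ := by linarith
    positivity
  refine ⟨x₀, ⟨h0, fun x hx => ?_⟩, hl, hr, fun x h3 hx => ?_, fun x hx => ?_⟩
  · by_contra! h
    have h1 : cubic x = 0 := hx
    rw [hfac] at h1
    have := mul_pos (sub_pos.2 h) (hpos x (by linarith))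
    linarith
  · rcases le_total x 4 with h | h
    -- Here `cubic x = -1 - (4 - x)(x² - x - 4)`.
    · have h1 : 0 ≤ (4 - x) * (x ^ 2 - x - 4) :=
        mul_nonneg (by linarith) (by nlinarith)
      simp only [cubic]
      nlinarith
    · rw [hfac]
      exact mul_neg_of_neg_of_pos (by linarith) (hpos x h)
  · rw [hfac]
    exact mul_nonneg (by linarith) (hpos x (by linarith)).le

/-! ### Derivatives and the sign of the denominator -/

lemma hasDerivAt_logNum {x : ℝ} (hx : 3 ≤ x) (hc : cubic x < 0) :
    HasDerivAt logNum (x ^ 2 * (x ^ 2 - 9) / ((x ^ 2 - 3) * cubic x)) x := by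
  have h3 : 0 < x ^ 2 - 3 := by nlinarith
  have hc' : x ^ 3 - 5 * x ^ 2 + 15 < 0 := hc
  have hne : -(2 * (x ^ 3 - 5 * x ^ 2 + 15) / (x ^ 2 - 3)) ≠ 0 :=
    neg_ne_zero.2 (div_ne_zero (by linarith) h3.ne')
  have h1 : HasDerivAt (fun x : ℝ => 2 * (x ^ 3 - 5 * x ^ 2 + 15))
      (2 * (3 * x ^ 2 - 10 * x)) x := by
    have := ((((hasDerivAt_id x).pow 3).sub
      (((hasDerivAt_id x).pow 2).const_mul 5)).add_const 15).const_mul 2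
    convert! this using 1
    simp
    ring
  have h2 : HasDerivAt (fun x : ℝ => x ^ 2 - 3) (2 * x) x := by
    have := ((hasDerivAt_id x).pow 2).sub_const 3
    convert! this using 1
    simp
  have h4 := ((h1.div h2 h3.ne').neg).log hne
  unfold logNum
  convert! h4 using 1
  simp only [Pi.neg_apply, Pi.div_apply, cubic]
  have := hc'.ne
  have := h3.ne'
  field_simp
  ring

lemma hasDerivAt_logDen {x : ℝ} (hx : 3 ≤ x) :
    HasDerivAt logDen (2 * x * (9 - x ^ 2) / ((x ^ 2 - 3) * (x ^ 2 + 3))) x := by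
  have h3 : 0 < x ^ 2 - 3 := by nlinarith
  have h3' : 0 < x ^ 2 + 3 := by nlinarith
  have hne : 24 * (x ^ 2 - 3) / (x ^ 2 + 3) ^ 2 ≠ 0 := by positivity
  have h1 : HasDerivAt (fun x : ℝ => 24 * (x ^ 2 - 3)) (24 * (2 * x)) x := by
    have := (((hasDerivAt_id x).pow 2).sub_const 3).const_mul 24
    convert! this using 1
    simp
  have h2 : HasDerivAt (fun x : ℝ => (x ^ 2 + 3) ^ 2) (2 * (x ^ 2 + 3) * (2 * x)) x := by
    have := (((hasDerivAt_id x).pow 2).add_const 3).pow 2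
    convert! this using 1
    simp
  have h4 := (h1.div h2 (by positivity)).log hne
  unfold logDen
  convert! h4 using 1
  simp only [Pi.div_apply]
  have := h3.ne'
  field_simp
  ring

lemma hasDerivAt_derivRatio {x : ℝ} (hc : cubic x < 0) :
    HasDerivAt derivRatio
      ((5 * x ^ 4 + 6 * x ^ 3 - 60 * x ^ 2 - 45) / (2 * cubic x ^ 2)) x := by
  have hc' : x ^ 3 - 5 * x ^ 2 + 15 < 0 := hc
  have h1 : HasDerivAt (fun x : ℝ => -(2 * (x ^ 3 - 5 * x ^ 2 + 15)))
      (-(2 * (3 * x ^ 2 - 10 * x))) x := by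
    have := (((((hasDerivAt_id x).pow 3).sub
      (((hasDerivAt_id x).pow 2).const_mul 5)).add_const 15).const_mul 2).neg
    convert! this using 1
    simp
    ring
  have h2 : HasDerivAt (fun x : ℝ => x * (x ^ 2 + 3)) (3 * x ^ 2 + 3) x := by
    have := (hasDerivAt_id x).mul (((hasDerivAt_id x).pow 2).add_const 3)
    convert! this using 1
    simp
    ring
  have h4 := h2.div h1 (by linarith)
  unfold derivRatio cubic
  convert! h4 using 1
  have := hc'.ne
  field_simp
  ring

lemma logDen_neg {x : ℝ} (hx : 3 < x) : logDen x < 0 := by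
  have h3 : 0 < x ^ 2 - 3 := by nlinarith
  refine Real.log_neg (by positivity) ?_
  rw [div_lt_one (by positivity)]
  -- `(x² + 3)² - 24(x² - 3) = (x² - 9)²`.
  have : 0 < (x ^ 2 - 9) ^ 2 := pow_pos (by nlinarith) 2
  nlinarith

lemma critical_three : critical 3 = 0 := by
  norm_num [critical, logDen, logNum]

/-- With `q = N' / D'` the terms `N' - q D'` cancel, leaving `-q' D`. The factor `x² - 9` common to
`N'` and `D'` has dropped out of `q`, so this holds at `x = 3` too. -/
lemma hasDerivAt_critical {x : ℝ} (hx : 3 ≤ x) (hc : cubic x < 0) :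
    HasDerivAt critical
      (-((5 * x ^ 4 + 6 * x ^ 3 - 60 * x ^ 2 - 45) / (2 * cubic x ^ 2) * logDen x)) x := by
  have h := (hasDerivAt_logNum hx hc).sub ((hasDerivAt_derivRatio hc).mul (hasDerivAt_logDen hx))
  unfold critical
  convert! h using 1
  have h3 : x ^ 2 - 3 ≠ 0 := by nlinarith
  have := hc.ne
  simp only [derivRatio]
  field_simp
  ring

lemma hasDerivAt_f {x : ℝ} (hx : 3 < x) (hc : cubic x < 0) :
    HasDerivAt f (2 * x * (9 - x ^ 2) / ((x ^ 2 - 3) * (x ^ 2 + 3)) *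
      -critical x / logDen x ^ 2) x := by
  have h := (hasDerivAt_logNum hx.le hc).div (hasDerivAt_logDen hx.le) (logDen_neg hx).ne
  convert! h using 1
  have h3 : x ^ 2 - 3 ≠ 0 := by nlinarith
  have := hc.ne
  have := (logDen_neg hx).ne
  simp only [critical, derivRatio]
  field_simp
  ring

/-! ### Locating the critical point -/

lemma quartic_strictMono {x y : ℝ} (hx : 3 ≤ x) (hxy : x < y) :
    5 * x ^ 4 + 6 * x ^ 3 - 60 * x ^ 2 - 45 < 5 * y ^ 4 + 6 * y ^ 3 - 60 * y ^ 2 - 45 := by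
  have h : 0 < (y - x) * (5 * (y + x) * (y ^ 2 + x ^ 2 - 12) + 6 * (y ^ 2 + x * y + x ^ 2)) := by
    refine mul_pos (by linarith) (add_pos (mul_pos (by linarith) ?_) ?_)
    · nlinarith
    · nlinarith
  nlinarith

lemma exists_quartic_root :
    ∃ x₂ : ℝ, 3.05 < x₂ ∧ x₂ < 3.06 ∧ 5 * x₂ ^ 4 + 6 * x₂ ^ 3 - 60 * x₂ ^ 2 - 45 = 0 := by
  have hc : ContinuousOn (fun x : ℝ => 5 * x ^ 4 + 6 * x ^ 3 - 60 * x ^ 2 - 45)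
      (Icc 3.05 3.06) := by fun_prop
  obtain ⟨x₂, ⟨hl, hr⟩, h0⟩ := intermediate_value_Ioo (by norm_num) hc
    (show (0 : ℝ) ∈ Ioo _ _ by constructor <;> norm_num)
  exact ⟨x₂, hl, hr, h0⟩

lemma le_log_div {z : ℝ} (h₀ : 0 ≤ z) (h₁ : z < 1) :
    2 * (z + z ^ 3 / 3 + z ^ 5 / 5) ≤ Real.log ((1 + z) / (1 - z)) := by
  have h := Real.sum_range_le_log_div h₀ h₁ 3
  simp only [Finset.sum_range_succ, Finset.sum_range_zero] at h
  norm_num at h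
  linarith

lemma log_div_le {z : ℝ} (h₀ : 0 ≤ z) (h₁ : z < 1) :
    Real.log ((1 + z) / (1 - z)) ≤
      2 * (z + z ^ 3 / 3 + z ^ 5 / 5 + z ^ 7 / (1 - z ^ 2)) := by
  have h := Real.log_div_le_sum_range_add h₀ h₁ 3
  simp only [Finset.sum_range_succ, Finset.sum_range_zero] at h
  norm_num at h
  linarith

lemma neg_logNum (x : ℝ) : -logNum x = Real.log ((x ^ 2 - 3) / -(2 * cubic x)) := by
  rw [logNum, ← Real.log_inv, cubic, ← neg_div, inv_div, div_neg]

lemma neg_logDen (x : ℝ) : -logDen x = Real.log ((x ^ 2 + 3) ^ 2 / (24 * (x ^ 2 - 3))) := by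
  rw [logDen, ← Real.log_inv, inv_div]

/-- Both logarithms are of the form `log ((1 + z) / (1 - z))` with small `z`. The decimals are such
`z`, rounded in the direction each bound needs, and three terms of the series separate `critical`
from `0`. The same method serves for `critical_right_pos`. -/
lemma critical_left_neg : critical 3.0678739785 < 0 := by
  have hA : 2 * (0.0032927974508774018 + 0.0032927974508774018 ^ 3 / 3
      + 0.0032927974508774018 ^ 5 / 5) ≤ -logNum 3.0678739785 := by
    refine (le_log_div (by norm_num) (by norm_num)).trans ?_
    rw [neg_logNum]
    refine Real.log_le_log (by norm_num) ?_
    norm_num [cubic]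
  have hB : -logDen 3.0678739785 ≤ 2 * (0.0005508277214814784 + 0.0005508277214814784 ^ 3 / 3
      + 0.0005508277214814784 ^ 5 / 5
      + 0.0005508277214814784 ^ 7 / (1 - 0.0005508277214814784 ^ 2)) := by
    refine le_trans ?_ (log_div_le (by norm_num) (by norm_num))
    rw [neg_logDen]
    refine Real.log_le_log (by norm_num) ?_
    norm_num
  have hL : derivRatio 3.0678739785 ≤ 5.97792901526663 := by norm_num [derivRatio, cubic]
  have hB0 := logDen_neg (x := 3.0678739785) (by norm_num)
  have hLB := mul_le_mul hL hB (by linarith) (by norm_num)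
  norm_num at hA hLB
  simp only [critical]
  norm_num
  linarith

lemma critical_right_pos : 0 < critical 3.067873979 := by
  have hA : -logNum 3.067873979 ≤ 2 * (0.00329279749833147297 + 0.00329279749833147297 ^ 3 / 3
      + 0.00329279749833147297 ^ 5 / 5
      + 0.00329279749833147297 ^ 7 / (1 - 0.00329279749833147297 ^ 2)) := by
    refine le_trans ?_ (log_div_le (by norm_num) (by norm_num))
    rw [neg_logNum]
    refine Real.log_le_log (by norm_num [cubic]) ?_
    norm_num [cubic]
  have hB : 2 * (0.00055082772941977453 + 0.00055082772941977453 ^ 3 / 3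
      + 0.00055082772941977453 ^ 5 / 5) ≤ -logDen 3.067873979 := by
    refine (le_log_div (by norm_num) (by norm_num)).trans ?_
    rw [neg_logDen]
    refine Real.log_le_log (by norm_num) ?_
    norm_num
  have hL : 5.9779290154255953 ≤ derivRatio 3.067873979 := by norm_num [derivRatio, cubic]
  have hLB := mul_le_mul hL hB (by norm_num) (by linarith)
  norm_num at hA hLB
  simp only [critical]
  norm_num
  linarith

/-- The critical point of `f`, its position and value, and the monotonicity of `f`. -/
lemma exists_critical {x₀ : ℝ} (h₀ : 4 < x₀) (hcubic : ∀ x, 3 ≤ x → x < x₀ → cubic x < 0) :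
    ∃ x₁ : ℝ, 3.0678739785 < x₁ ∧ x₁ < 3.067873979 ∧ |f x₁ - 5.977929015| < 5e-10 ∧
      (∀ x, 3 < x → x < x₁ → critical x < 0) ∧ critical x₁ = 0 ∧
      ∀ x, x₁ < x → x < x₀ → 0 < critical x := by
  obtain ⟨x₂, hl, hr, hx₂⟩ := exists_quartic_root
  have hneg : ∀ x, 3 ≤ x → x < x₂ → 5 * x ^ 4 + 6 * x ^ 3 - 60 * x ^ 2 - 45 < 0 :=
    fun x h3 h => hx₂ ▸ quartic_strictMono h3 h
  have hpos : ∀ x, x₂ < x → 0 < 5 * x ^ 4 + 6 * x ^ 3 - 60 * x ^ 2 - 45 :=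
    fun x h => hx₂ ▸ quartic_strictMono (by linarith) h
  have hanti : StrictAntiOn critical (Icc 3 x₂) := by
    refine strictAntiOn_of_deriv_neg (convex_Icc _ _) (fun x hx =>
      (hasDerivAt_critical hx.1 (hcubic x hx.1 (by linarith [hx.2]))).continuousAt.continuousWithinAt)
      fun x hx => ?_
    rw [interior_Icc] at hx
    have hc := hcubic x hx.1.le (by linarith [hx.2])
    rw [(hasDerivAt_critical hx.1.le hc).deriv, neg_lt_zero]
    exact mul_pos_of_neg_of_neg (div_neg_of_neg_of_pos (hneg x hx.1.le hx.2)
      (mul_pos two_pos (sq_pos_of_neg hc))) (logDen_neg hx.1)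
  have hmono : StrictMonoOn critical (Ico x₂ x₀) := by
    refine strictMonoOn_of_deriv_pos (convex_Ico _ _) (fun x hx =>
      (hasDerivAt_critical (by linarith [hx.1])
        (hcubic x (by linarith [hx.1]) hx.2)).continuousAt.continuousWithinAt)
      fun x hx => ?_
    rw [interior_Ico] at hx
    have h3 : 3 < x := by linarith [hx.1]
    have hc := hcubic x h3.le hx.2
    rw [(hasDerivAt_critical h3.le hc).deriv, neg_pos]
    exact mul_neg_of_pos_of_neg (div_pos (hpos x hx.1)
      (mul_pos two_pos (sq_pos_of_neg hc))) (logDen_neg h3)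
  -- The numerator of `q'` is the same quartic, so `q` increases beyond `x₂` and its values at the
  -- two decimal endpoints bracket `q x₁ = f x₁`.
  have hratio : StrictMonoOn derivRatio (Ico x₂ x₀) := by
    refine strictMonoOn_of_deriv_pos (convex_Ico _ _) (fun x hx =>
      (hasDerivAt_derivRatio
        (hcubic x (by linarith [hx.1]) hx.2)).continuousAt.continuousWithinAt)
      fun x hx => ?_
    rw [interior_Ico] at hx
    have hc := hcubic x (by linarith [hx.1]) hx.2
    rw [(hasDerivAt_derivRatio hc).deriv]
    exact div_pos (hpos x hx.1) (mul_pos two_pos (sq_pos_of_neg hc))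
  have hcont : ContinuousOn critical (Icc 3.0678739785 3.067873979) := fun x hx =>
    (hasDerivAt_critical (by linarith [hx.1]) (hcubic x (by linarith [hx.1])
      (by linarith [hx.2]))).continuousAt.continuousWithinAt
  obtain ⟨x₁, ⟨hl₁, hr₁⟩, h0⟩ := intermediate_value_Ioo (by norm_num) hcont
    (show (0 : ℝ) ∈ Ioo _ _ from ⟨critical_left_neg, critical_right_pos⟩)
  have hmem : x₁ ∈ Ico x₂ x₀ := ⟨by linarith, by linarith⟩
  refine ⟨x₁, hl₁, hr₁, ?_, fun x h3 hx => ?_, h0, fun x hx hx₀ => ?_⟩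
  · have hf : f x₁ = derivRatio x₁ := by
      have : f x₁ = logNum x₁ / logDen x₁ := rfl
      rw [this, div_eq_iff (logDen_neg (by linarith)).ne]
      exact sub_eq_zero.1 h0
    have h1 := hratio ⟨by linarith, by linarith⟩ hmem hl₁
    have h2 := hratio hmem ⟨by linarith, by linarith⟩ hr₁
    have h3 : 5.977929015 - 5e-10 < derivRatio 3.0678739785 := by
      norm_num [derivRatio, cubic]
    have h4 : derivRatio 3.067873979 < 5.977929015 + 5e-10 := by
      norm_num [derivRatio, cubic]
    rw [hf, abs_lt]
    constructor <;> linarith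
  · rcases le_total x x₂ with h | h
    · rw [← critical_three]
      exact hanti ⟨le_rfl, by linarith⟩ ⟨h3.le, h⟩ h3
    · rw [← h0]
      exact hmono ⟨h, by linarith⟩ hmem hx
  · rw [← h0]
    exact hmono hmem ⟨by linarith, hx₀⟩ hx

lemma f_critical_lt {x₀ x₁ : ℝ} (h₁ : 3 < x₁) (h₁₀ : x₁ < x₀)
    (hcubic : ∀ x, 3 ≤ x → x < x₀ → cubic x < 0)
    (hneg : ∀ x, 3 < x → x < x₁ → critical x < 0)
    (hpos : ∀ x, x₁ < x → x < x₀ → 0 < critical x) {x : ℝ} (h3 : 3 < x) (hx₀ : x < x₀)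
    (hne : x ≠ x₁) : f x₁ < f x := by
  have hfac : ∀ x : ℝ, 3 < x → 2 * x * (9 - x ^ 2) / ((x ^ 2 - 3) * (x ^ 2 + 3)) < 0 := by
    intro x hx
    have : 0 < x ^ 2 - 3 := by nlinarith
    refine div_neg_of_neg_of_pos (mul_neg_of_pos_of_neg (by linarith) (by nlinarith))
      (by positivity)
  rcases hne.lt_or_gt with h | h
  · have hanti : StrictAntiOn f (Ioc 3 x₁) := by
      refine strictAntiOn_of_deriv_neg (convex_Ioc _ _) (fun y hy => (hasDerivAt_f hy.1
        (hcubic y hy.1.le (by linarith [hy.2]))).continuousAt.continuousWithinAt) fun y hy => ?_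
      rw [interior_Ioc] at hy
      rw [(hasDerivAt_f hy.1 (hcubic y hy.1.le (by linarith [hy.2]))).deriv]
      exact div_neg_of_neg_of_pos (mul_neg_of_neg_of_pos (hfac y hy.1)
        (neg_pos.2 (hneg y hy.1 hy.2))) (sq_pos_of_neg (logDen_neg hy.1))
    exact hanti ⟨h3, h.le⟩ ⟨h₁, le_rfl⟩ h
  · have hmono : StrictMonoOn f (Ico x₁ x₀) := by
      refine strictMonoOn_of_deriv_pos (convex_Ico _ _) (fun y hy => (hasDerivAt_f
        (by linarith [hy.1]) (hcubic y (by linarith [hy.1])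
          hy.2)).continuousAt.continuousWithinAt) fun y hy => ?_
      rw [interior_Ico] at hy
      have h3 : 3 < y := by linarith [hy.1]
      rw [(hasDerivAt_f h3 (hcubic y h3.le hy.2)).deriv]
      exact div_pos (mul_pos_of_neg_of_neg (hfac y h3)
        (neg_lt_zero.2 (hpos y hy.1 hy.2))) (sq_pos_of_neg (logDen_neg h3))
    exact hmono ⟨le_rfl, h₁₀⟩ ⟨h.le, hx₀⟩ h

/-! ### From the power inequality to a bound on the exponent -/

lemma ten_sub_eq {x : ℝ} (hx : x ^ 2 - 3 ≠ 0) :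
    10 - 2 * x ^ 3 / (x ^ 2 - 3) = -(2 * (x ^ 3 - 5 * x ^ 2 + 15) / (x ^ 2 - 3)) := by
  field_simp
  ring

/-- Comparison of the power with the value it has to exceed, in terms of `f`. -/
lemma lt_rpow_iff {x l : ℝ} (hx : 3 < x) (hc : cubic x < 0) :
    10 - 2 * x ^ 3 / (x ^ 2 - 3) < (24 * (x ^ 2 - 3) / (x ^ 2 + 3) ^ 2) ^ l ↔ l < f x := by
  have h3 : 0 < x ^ 2 - 3 := by nlinarith
  have hB := logDen_neg hx
  have hc' : x ^ 3 - 5 * x ^ 2 + 15 < 0 := hc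
  have hpos : 0 < -(2 * (x ^ 3 - 5 * x ^ 2 + 15) / (x ^ 2 - 3)) :=
    neg_pos.2 (div_neg_of_neg_of_pos (by linarith) h3)
  rw [ten_sub_eq h3.ne', ← Real.log_lt_log_iff hpos (Real.rpow_pos_of_pos (by positivity) _),
    Real.log_rpow (by positivity)]
  -- The base is below `1`, so dividing by its logarithm reverses the inequality.
  exact (lt_div_iff_of_neg hB).symm

lemma rpow_lt_iff {x l : ℝ} (hx : 3 < x) (hc : cubic x < 0) :
    (24 * (x ^ 2 - 3) / (x ^ 2 + 3) ^ 2) ^ l < 10 - 2 * x ^ 3 / (x ^ 2 - 3) ↔ f x < l := by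
  have h3 : 0 < x ^ 2 - 3 := by nlinarith
  have hB := logDen_neg hx
  have hc' : x ^ 3 - 5 * x ^ 2 + 15 < 0 := hc
  have hpos : 0 < -(2 * (x ^ 3 - 5 * x ^ 2 + 15) / (x ^ 2 - 3)) :=
    neg_pos.2 (div_neg_of_neg_of_pos (by linarith) h3)
  rw [ten_sub_eq h3.ne', ← Real.log_lt_log_iff (Real.rpow_pos_of_pos (by positivity) _) hpos,
    Real.log_rpow (by positivity)]
  exact (div_lt_iff_of_neg hB).symm

/-! ### The fundamental inequality and its isosceles extremals -/

/-- The larger solution `y = x ^ 2` of `24 (y - 3) / (y + 3) ^ 2 = 1 / ρ`. -/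
lemma exists_isosceles_parameter {ρ : ℝ} (hρ : 1 ≤ ρ) :
    ∃ y : ℝ, 9 ≤ y ∧ (y + 3) ^ 2 = 24 * ρ * (y - 3) := by
  refine ⟨12 * ρ - 3 + 12 * √(ρ * (ρ - 1)), ?_, ?_⟩
  · have := Real.sqrt_nonneg (ρ * (ρ - 1))
    linarith
  · have := Real.sq_sqrt (show 0 ≤ ρ * (ρ - 1) by nlinarith)
    linear_combination 144 * this

/-- The fundamental inequality of the triangle, for a triangle of inradius `1`, in terms of the
parameter `y` of the isosceles triangles with the same circumradius. -/
lemma fundamental_inequality {u v w ρ y : ℝ}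
    (hprod : u * v * w = u + v + w) (hsum : u * v + v * w + w * u = 1 + 8 * ρ)
    (hy : 9 ≤ y) (hρ : (y + 3) ^ 2 = 24 * ρ * (y - 3)) :
    4 * y ^ 3 / (3 * (y - 3) ^ 2) ≤ (u + v + w) ^ 2 ∧
      ((u + v + w) ^ 2 = 4 * y ^ 3 / (3 * (y - 3) ^ 2) → u = v ∨ v = w ∨ w = u) := by
  have hy3 : 0 < y - 3 := by linarith
  -- Discriminant of `t³ - s t² + (1 + 8ρ) t - s`, with `s = u + v + w`, factored in `s²`. The
  -- second zero comes from the other solution `y'` of the equation for `y`, given by `(y - 3)(y' -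
  -- 3) = 36`.
  have hdisc : ((u - v) * (v - w) * (w - u)) ^ 2 = -4 *
      (((u + v + w) ^ 2 - 4 * y ^ 3 / (3 * (y - 3) ^ 2)) *
      ((u + v + w) ^ 2 - (y + 9) ^ 3 / (36 * (y - 3)))) := by
    have hρ' : ρ = (y + 3) ^ 2 / (24 * (y - 3)) := by
      rw [hρ]; field_simp
    have h1 : ((u - v) * (v - w) * (w - u)) ^ 2 =
        (u + v + w) ^ 2 * (1 + 8 * ρ) ^ 2 - 4 * (1 + 8 * ρ) ^ 3 - 4 * (u + v + w) ^ 4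
        + 18 * (u + v + w) ^ 2 * (1 + 8 * ρ) - 27 * (u + v + w) ^ 2 := by
      rw [← hsum]
      have : ((u - v) * (v - w) * (w - u)) ^ 2 =
        (u + v + w) ^ 2 * (u * v + v * w + w * u) ^ 2 - 4 * (u * v + v * w + w * u) ^ 3
        - 4 * (u + v + w) ^ 3 * (u * v * w)
        + 18 * (u + v + w) * (u * v * w) * (u * v + v * w + w * u) - 27 * (u * v * w) ^ 2 := by
        ring
      rw [this, hprod]
      ring
    rw [h1, hρ']
    field_simp
    ring
  have hle : (4 * y ^ 3 / (3 * (y - 3) ^ 2)) ≤ (y + 9) ^ 3 / (36 * (y - 3)) := by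
    rw [div_le_div_iff₀ (by positivity) (by positivity)]
    have : 0 ≤ (y - 9) ^ 3 * (y + 3) * (3 * (y - 3)) :=
      mul_nonneg (mul_nonneg (pow_nonneg (by linarith) 3) (by linarith)) (by linarith)
    nlinarith
  have hsq := sq_nonneg ((u - v) * (v - w) * (w - u))
  refine ⟨?_, fun h => ?_⟩
  · by_contra! h
    have := mul_pos_of_neg_of_neg (sub_neg.2 h) (sub_neg.2 (h.trans_le hle))
    linarith
  · rw [h, sub_self, zero_mul, mul_zero] at hdisc
    have := pow_eq_zero_iff (two_ne_zero) |>.1 hdisc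
    rcases mul_eq_zero.1 this with h | h
    · rcases mul_eq_zero.1 h with h | h
      · exact Or.inl (sub_eq_zero.1 h)
      · exact Or.inr (Or.inl (sub_eq_zero.1 h))
    · exact Or.inr (Or.inr (sub_eq_zero.1 h))

/-- An isosceles triangle attaining the minimum is the one given by the parameter. -/
lemma isosceles_ratio {u v ρ y : ℝ} (hu : 0 < u) (hv : 0 < v)
    (hprod : u * v ^ 2 = u + 2 * v) (hsum : 2 * (u * v) + v ^ 2 = 1 + 8 * ρ)
    (hy : 9 ≤ y) (hρ : (y + 3) ^ 2 = 24 * ρ * (y - 3))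
    (hmin : (u + 2 * v) ^ 2 = 4 * y ^ 3 / (3 * (y - 3) ^ 2)) :
    v * (y + 3) = (u + v) * (y - 3) := by
  have hv1 : 0 < v ^ 2 - 1 := by
    have : 0 < u * (v ^ 2 - 1) := by nlinarith
    exact pos_of_mul_pos_right this hu.le
  have hu' : u = 2 * v / (v ^ 2 - 1) := by
    rw [eq_div_iff hv1.ne']; linarith
  have hy3 : 0 < y - 3 := by linarith
  have hρ' : ρ = (y + 3) ^ 2 / (24 * (y - 3)) := by
    rw [hρ]; field_simp
  -- `3v²` must be `y` or its conjugate `y'`. The conjugate has the larger perimeter, so minimality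
  -- then forces `y = y' = 9`.
  have hroots : (3 * v ^ 2 - y) * ((3 * v ^ 2 - 3) * (y - 3) - 36) = 0 := by
    rw [hρ', hu'] at hsum
    field_simp at hsum
    linear_combination (3 / 8) * hsum
  have hyv : y = 3 * v ^ 2 := by
    rcases mul_eq_zero.1 hroots with h | h
    · linarith
    · have hs : v ^ 2 - 1 = 12 / (y - 3) := by
        rw [eq_div_iff hy3.ne']; linarith
      have h1 : (u + 2 * v) ^ 2 = 4 * (v ^ 2) ^ 3 / (v ^ 2 - 1) ^ 2 := by
        rw [← hprod, hu']; field_simp; ring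
      have hs' : v ^ 2 = (y + 9) / (y - 3) := by
        rw [eq_div_iff hy3.ne']; linarith
      rw [h1, hs, hs'] at hmin
      field_simp at hmin
      have h9 : (y - 9) ^ 3 * (y + 3) = 0 := by linear_combination (1 / 3) * hmin
      have h9' : y = 9 := by
        rcases mul_eq_zero.1 h9 with h | h
        · exact sub_eq_zero.1 (pow_eq_zero_iff three_ne_zero |>.1 h)
        · linarith
      subst h9'
      linarith
  rw [hyv, hu']
  field_simp
  ring

/-! ### Area, inradius and circumradius from side lengths -/

/-- The square of twice the area of a triangle, in terms of its side lengths. -/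
def gram (a b c : ℝ) : ℝ := (a + b + c) * (b + c - a) * (c + a - b) * (a + b - c) / 4

section Geometry

open scoped RealInnerProductSpace EuclideanGeometry

variable {V P : Type*} [NormedAddCommGroup V] [InnerProductSpace ℝ V] [MetricSpace P]
  [NormedAddTorsor V P]

lemma gram_eq (p q r : P) :
    ⟪p -ᵥ q, p -ᵥ q⟫ * ⟪r -ᵥ q, r -ᵥ q⟫ - ⟪p -ᵥ q, r -ᵥ q⟫ * ⟪p -ᵥ q, r -ᵥ q⟫ =
      gram (dist p q) (dist q r) (dist r p) := by
  have h : dist r p * dist r p = dist p q * dist p q + dist q r * dist q r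
      - 2 * ⟪p -ᵥ q, r -ᵥ q⟫ := by
    rw [dist_eq_norm_vsub V r p, ← vsub_sub_vsub_cancel_right r p q, norm_sub_mul_self_real,
      dist_eq_norm_vsub V p q, dist_comm q r, dist_eq_norm_vsub V r q, real_inner_comm]
    ring
  rw [real_inner_self_eq_norm_mul_norm, real_inner_self_eq_norm_mul_norm, ← dist_eq_norm_vsub,
    ← dist_eq_norm_vsub, dist_comm r q]
  have h' : ⟪p -ᵥ q, r -ᵥ q⟫ =
    (dist p q * dist p q + dist q r * dist q r - dist r p * dist r p) / 2 := by linarith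
  rw [h', gram]
  ring

lemma height_mul_dist_sq (T : Affine.Triangle ℝ P) {i j k : Fin 3} (hij : i ≠ j) (hik : i ≠ k)
    (hjk : j ≠ k) :
    (T.height i * dist (T.points j) (T.points k)) ^ 2 =
      gram (dist (T.points i) (T.points j)) (dist (T.points j) (T.points k))
        (dist (T.points k) (T.points i)) := by
  have hmem : T.altitudeFoot i ∈ line[ℝ, T.points j, T.points k] := by
    have h := T.altitudeFoot_mem_affineSpan_image_compl i
    have hc : ({i}ᶜ : Set (Fin 3)) = {j, k} := by
      ext l; simp only [mem_compl_iff, mem_singleton_iff, mem_insert_iff]; omega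
    rwa [hc, image_pair] at h
  obtain ⟨t, ht⟩ := mem_affineSpan_pair_iff_exists_lineMap_eq.1 hmem
  have h1 : T.altitudeFoot i -ᵥ T.points j = t • (T.points k -ᵥ T.points j) := by
    rw [← ht, AffineMap.lineMap_apply, vadd_vsub]
  have hj := T.inner_vsub_vsub_altitudeFoot_eq_height_sq hij
  have hk := T.inner_vsub_vsub_altitudeFoot_eq_height_sq hik
  have h2 : T.points i -ᵥ T.altitudeFoot i =
      (T.points i -ᵥ T.points j) - t • (T.points k -ᵥ T.points j) := by
    rw [← h1, vsub_sub_vsub_cancel_right]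
  rw [← vsub_sub_vsub_cancel_right (T.points i) (T.points k) (T.points j)] at hk
  rw [h2, inner_sub_right, inner_smul_right] at hj hk
  rw [inner_sub_left, inner_sub_left] at hk
  have h3 : dist (T.points j) (T.points k) ^ 2 =
      ⟪T.points k -ᵥ T.points j, T.points k -ᵥ T.points j⟫ := by
    rw [dist_comm, dist_eq_norm_vsub V, real_inner_self_eq_norm_sq]
  -- Subtracting the two height identities says that the altitude is orthogonal to the opposite
  -- side.
  have hp : ⟪T.points i -ᵥ T.points j, T.points k -ᵥ T.points j⟫ =
      t * ⟪T.points k -ᵥ T.points j, T.points k -ᵥ T.points j⟫ := by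
    rw [real_inner_comm (T.points i -ᵥ T.points j) (T.points k -ᵥ T.points j)] at hk
    linarith
  rw [← gram_eq, mul_pow, ← hj, h3]
  linear_combination ⟪T.points i -ᵥ T.points j, T.points k -ᵥ T.points j⟫ * hp

/-- Relations between the sides, the inradius and the circumradius of a triangle, in terms of
twice its area `S`. -/
lemma exists_area (T : Affine.Triangle ℝ P) {a b c : ℝ}
    (ha : dist (T.points 1) (T.points 2) = a) (hb : dist (T.points 2) (T.points 0) = b)
    (hc : dist (T.points 0) (T.points 1) = c) :
    ∃ S : ℝ, 0 < S ∧ S ^ 2 = gram a b c ∧ T.inradius * (a + b + c) = S ∧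
      2 * T.circumradius * S = a * b * c := by
  have h01 : (0 : Fin 3) ≠ 1 := by decide
  have h02 : (0 : Fin 3) ≠ 2 := by decide
  have h12 : (1 : Fin 3) ≠ 2 := by decide
  have ha0 : 0 < a := ha ▸ dist_pos.2 (T.independent.injective.ne h12)
  have hb0 : 0 < b := hb ▸ dist_pos.2 (T.independent.injective.ne h02.symm)
  have hc0 : 0 < c := hc ▸ dist_pos.2 (T.independent.injective.ne h01)
  have hh0 := T.height_pos 0
  have hh1 := T.height_pos 1
  have hh2 := T.height_pos 2
  have e0 := height_mul_dist_sq T h01 h02 h12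
  have e1 := height_mul_dist_sq T h12 h01.symm h02.symm
  have e2 := height_mul_dist_sq T h02.symm h12.symm h01
  rw [hc, ha, hb] at e0
  rw [hc, ha, hb] at e1
  rw [hc, ha, hb] at e2
  have hg1 : gram a b c = gram c a b := by simp only [gram]; ring
  have hg2 : gram b c a = gram c a b := by simp only [gram]; ring
  have e01 : T.height 1 * b = T.height 0 * a :=
    (sq_eq_sq₀ (by positivity) (by positivity)).1 (by rw [e0, e1, hg1])
  have e02 : T.height 2 * c = T.height 0 * a :=
    (sq_eq_sq₀ (by positivity) (by positivity)).1 (by rw [e0, e2, hg2])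
  refine ⟨T.height 0 * a, by positivity, by rw [e0, hg1], ?_, ?_⟩
  · have hr : T.inradius = (∑ i, (T.height i)⁻¹)⁻¹ := by
      rw [Affine.Simplex.inradius_eq_abs_inv_sum, abs_of_pos]
      · simp
      · exact inv_pos.2 T.sum_excenterWeightsUnnorm_empty_pos
    rw [hr, Fin.sum_univ_three, inv_mul_eq_iff_eq_mul₀ (by positivity), add_mul, add_mul]
    nth_rewrite 2 [← e01]
    nth_rewrite 2 [← e02]
    field_simp
  · have hR := T.dist_div_sin_angle_eq_two_mul_circumradius h01 h02 h12
    have hs := InnerProductGeometry.sin_angle_mul_norm_mul_norm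
      (T.points 0 -ᵥ T.points 1) (T.points 2 -ᵥ T.points 1)
    rw [gram_eq, ← dist_eq_norm_vsub, ← dist_eq_norm_vsub, dist_comm (T.points 2), ha, hb, hc,
      ← e0, Real.sqrt_sq (by positivity)] at hs
    rw [dist_comm, hb] at hR
    change _ / Real.sin (InnerProductGeometry.angle _ _) = _ at hR
    rw [← hR, ← hs]
    have : Real.sin (InnerProductGeometry.angle (T.points 0 -ᵥ T.points 1)
        (T.points 2 -ᵥ T.points 1)) ≠ 0 := by
      intro h
      rw [h, zero_mul] at hs
      have : 0 < T.height 0 * a := by positivity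
      linarith
    field_simp

end Geometry

/-- The lengths of the tangents from the vertices to the incircle, in units of the inradius. -/
lemma exists_tangent_lengths (T : Tri) :
    ∃ u v w : ℝ, 0 < u ∧ 0 < v ∧ 0 < w ∧
      dist (T.points 1) (T.points 2) = T.inradius * (v + w) ∧
      dist (T.points 2) (T.points 0) = T.inradius * (w + u) ∧
      dist (T.points 0) (T.points 1) = T.inradius * (u + v) ∧
      semiperimeter T = T.inradius * (u + v + w) ∧ u * v * w = u + v + w ∧
      u * v + v * w + w * u = 1 + 4 * (T.circumradius / T.inradius) := by
  obtain ⟨S, hS, hS2, hr, hR⟩ := exists_area T rfl rfl rfl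
  have hr0 := T.inradius_pos
  have t0 := dist_triangle (T.points 1) (T.points 0) (T.points 2)
  have t1 := dist_triangle (T.points 2) (T.points 1) (T.points 0)
  have t2 := dist_triangle (T.points 0) (T.points 2) (T.points 1)
  rw [dist_comm (T.points 1) (T.points 0), dist_comm (T.points 0) (T.points 2)] at t0
  rw [dist_comm (T.points 2) (T.points 1), dist_comm (T.points 1) (T.points 0)] at t1
  rw [dist_comm (T.points 0) (T.points 2), dist_comm (T.points 2) (T.points 1)] at t2
  simp only [semiperimeter]
  generalize dist (T.points 1) (T.points 2) = a at *
  generalize dist (T.points 2) (T.points 0) = b at *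
  generalize dist (T.points 0) (T.points 1) = c at *
  generalize T.inradius = r at *
  generalize T.circumradius = R at *
  have hg : 0 < gram a b c := hS2 ▸ pow_pos hS 2
  -- Positive area makes the triangle inequalities strict.
  have hx : b + c - a ≠ 0 := fun h => by simp [gram, h] at hg
  have hy : c + a - b ≠ 0 := fun h => by simp [gram, h] at hg
  have hz : a + b - c ≠ 0 := fun h => by simp [gram, h] at hg
  have hx0 : 0 < b + c - a := lt_of_le_of_ne (by linarith) hx.symm
  have hy0 : 0 < c + a - b := lt_of_le_of_ne (by linarith) hy.symm
  have hz0 : 0 < a + b - c := lt_of_le_of_ne (by linarith) hz.symm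
  have hp0 : 0 < a + b + c := by linarith
  have hr2 : 4 * r ^ 2 * (a + b + c) = (b + c - a) * (c + a - b) * (a + b - c) := by
    rw [← hr, gram] at hS2
    refine mul_left_cancel₀ hp0.ne' ?_
    linarith
  have hRr : 2 * R * r * (a + b + c) = a * b * c := by rw [← hR, ← hr]; ring
  refine ⟨(b + c - a) / (2 * r), (c + a - b) / (2 * r), (a + b - c) / (2 * r), by positivity,
    by positivity, by positivity, ?_, ?_, ?_, ?_, ?_, ?_⟩
  · field_simp; ring
  · field_simp; ring
  · field_simp; ring
  · field_simp; ring
  · field_simp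
    linear_combination -hr2
  · have h : (b + c - a) * (c + a - b) + (c + a - b) * (a + b - c) + (a + b - c) * (b + c - a) =
        4 * r ^ 2 + 16 * R * r := by
      refine mul_left_cancel₀ hp0.ne' ?_
      linear_combination (-1) * hr2 - 8 * hRr
    field_simp
    linear_combination h

/-- The sum of distances over all ordered pairs of vertices is symmetric and counts each side twice,
giving `4p`. -/
lemma semiperimeter_reindex (T : Tri) (σ : Equiv.Perm (Fin 3)) :
    semiperimeter (T.reindex σ) = semiperimeter T := by
  have h : ∀ T : Tri, semiperimeter T =
      (∑ i : Fin 3, ∑ j : Fin 3, dist (T.points i) (T.points j)) / 4 := by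
    intro T
    simp only [semiperimeter, Fin.sum_univ_three, dist_self, dist_comm (T.points 1) (T.points 0),
      dist_comm (T.points 2) (T.points 1), dist_comm (T.points 2) (T.points 0)]
    ring
  rw [h, h]
  congr 1
  simp only [Affine.Simplex.reindex_points, Function.comp_apply]
  rw [Equiv.sum_comp σ.symm (fun i => ∑ j, dist (T.points i) (T.points (σ.symm j)))]
  exact Finset.sum_congr rfl fun i _ =>
    Equiv.sum_comp σ.symm (fun j => dist (T.points i) (T.points j))

/-! ### The isosceles family and comparison with it -/

lemma HasSideRatio.relations {T : Tri} {x : ℝ} (hx : 3 ≤ x)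
    (h : HasSideRatio T (2 * (x ^ 2 - 3)) (x ^ 2 + 3) (x ^ 2 + 3)) :
    √3 * semiperimeter T = T.inradius * (2 * x ^ 3 / (x ^ 2 - 3)) ∧
      2 * T.inradius / T.circumradius = 24 * (x ^ 2 - 3) / (x ^ 2 + 3) ^ 2 := by
  obtain ⟨σ, k, hk, h12, h20, h01⟩ := h
  have hT := exists_tangent_lengths (T.reindex σ.symm)
  rw [semiperimeter_reindex, Affine.Simplex.inradius_reindex,
    Affine.Simplex.circumradius_reindex] at hT
  simp only [Affine.Simplex.reindex_points, Function.comp_apply, Equiv.symm_symm, h12, h20,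
    h01] at hT
  obtain ⟨u, v, w, hu, hv, hw, ha, hb, hc, hp, hprod, hsum⟩ := hT
  have hr := T.inradius_pos
  have hR := T.circumradius_pos
  have h3 : 0 < x ^ 2 - 3 := by nlinarith
  rw [hp]
  generalize T.inradius = r at *
  generalize T.circumradius = R at *
  obtain ⟨κ, rfl⟩ : ∃ κ, k = r * κ := ⟨k / r, by field_simp⟩
  have hκ : 0 < κ := pos_of_mul_pos_right hk hr.le
  simp only [mul_assoc] at ha hb hc
  have ha' := mul_left_cancel₀ hr.ne' ha
  have hb' := mul_left_cancel₀ hr.ne' hb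
  have hc' := mul_left_cancel₀ hr.ne' hc
  obtain rfl : u = 6 * κ := by linarith
  obtain rfl : v = κ * (x ^ 2 - 3) := by linarith
  obtain rfl : w = κ * (x ^ 2 - 3) := by linarith
  -- The relation `u v w = u + v + w` fixes the scale: `κ = x / (√3 (x² - 3))`.
  have h0 : κ ^ 2 * (3 * (x ^ 2 - 3) ^ 2) = x ^ 2 :=
    mul_left_cancel₀ (mul_pos two_pos hκ).ne' (by linear_combination hprod)
  have hs3 := Real.sq_sqrt (show (0 : ℝ) ≤ 3 by norm_num)
  have h1 : κ * √3 * (x ^ 2 - 3) = x := by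
    refine (sq_eq_sq₀ (by positivity) (by linarith)).1 ?_
    linear_combination κ ^ 2 * (x ^ 2 - 3) ^ 2 * hs3 + h0
  constructor
  · field_simp
    linear_combination 2 * x ^ 2 * h1
  · field_simp at hsum ⊢
    refine mul_left_cancel₀ h3.ne' ?_
    linear_combination 6 * (x ^ 2 - 3) ^ 2 * hsum - 2 * (x ^ 2 - 3) * r * (x ^ 2 + 9) * h0

/-- Comparison of a triangle with the isosceles triangle of the same inradius and circumradius
and the smaller perimeter. -/
lemma exists_isosceles_comparison (T : Tri) :
    ∃ x : ℝ, 3 ≤ x ∧ 2 * T.inradius / T.circumradius = 24 * (x ^ 2 - 3) / (x ^ 2 + 3) ^ 2 ∧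
      T.inradius * (2 * x ^ 3 / (x ^ 2 - 3)) ≤ √3 * semiperimeter T ∧
      (√3 * semiperimeter T = T.inradius * (2 * x ^ 3 / (x ^ 2 - 3)) →
        HasSideRatio T (2 * (x ^ 2 - 3)) (x ^ 2 + 3) (x ^ 2 + 3)) := by
  obtain ⟨u, v, w, hu, hv, hw, ha, hb, hc, hp, hprod, hsum⟩ := exists_tangent_lengths T
  have hr := T.inradius_pos
  have hR := T.circumradius_pos
  set ρ := T.circumradius / T.inradius / 2 with hρdef
  have hsum' : u * v + v * w + w * u = 1 + 8 * ρ := by rw [hsum, hρdef]; ring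
  -- Euler's inequality `R ≥ 2r`.
  have hρ1 : 1 ≤ ρ := by
    have h1 : 0 ≤ u * (v - w) ^ 2 + v * (w - u) ^ 2 + w * (u - v) ^ 2 := by positivity
    have h2 : 0 < u + v + w := by positivity
    have h3 : u * (v - w) ^ 2 + v * (w - u) ^ 2 + w * (u - v) ^ 2 =
        (u + v + w) * (8 * (ρ - 1)) := by
      have : u * (v - w) ^ 2 + v * (w - u) ^ 2 + w * (u - v) ^ 2 =
        (u + v + w) * (u * v + v * w + w * u) - 9 * (u * v * w) := by ring
      rw [this, hsum', hprod]; ring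
    rw [h3] at h1
    have := nonneg_of_mul_nonneg_right h1 h2
    linarith
  obtain ⟨y, hy, hyρ⟩ := exists_isosceles_parameter hρ1
  have hsq : √y ^ 2 = y := Real.sq_sqrt (by linarith)
  have hy3 : 0 < y - 3 := by linarith
  obtain ⟨hmin, heq⟩ := fundamental_inequality hprod hsum' hy hyρ
  have hs3 := Real.sq_sqrt (show (0 : ℝ) ≤ 3 by norm_num)
  have hphi : (2 * √y ^ 3 / (y - 3)) ^ 2 = 3 * (4 * y ^ 3 / (3 * (y - 3) ^ 2)) := by
    rw [div_pow, mul_pow, ← pow_mul, mul_comm 3 2, pow_mul, hsq]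
    field_simp
    norm_num
  have hp2 : (√3 * (u + v + w)) ^ 2 = 3 * (u + v + w) ^ 2 := by rw [mul_pow, hs3]
  have hp' : √3 * semiperimeter T = T.inradius * (√3 * (u + v + w)) := by rw [hp]; ring
  refine ⟨√y, Real.le_sqrt_of_sq_le (by linarith), ?_, ?_, ?_⟩
  · have hinv : 2 * T.inradius / T.circumradius = 1 / ρ := by rw [hρdef]; field_simp
    rw [hsq, hinv, hyρ]
    have : 0 < ρ := by linarith
    field_simp
  · rw [hsq, hp']
    refine mul_le_mul_of_nonneg_left ?_ hr.le
    refine (sq_le_sq₀ (by positivity) (by positivity)).1 ?_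
    rw [hphi, hp2]
    linarith
  · intro h
    rw [hsq] at h ⊢
    rw [hp'] at h
    have h' := congrArg (· ^ 2) (mul_left_cancel₀ hr.ne' h)
    simp only [hphi, hp2] at h'
    have h0 : (u + v + w) ^ 2 = 4 * y ^ 3 / (3 * (y - 3) ^ 2) := by linarith
    have key : ∀ s t : ℝ, 0 < s → 0 < t → s * t ^ 2 = u + v + w → s + 2 * t = u + v + w →
        2 * (s * t) + t ^ 2 = 1 + 8 * ρ →
        0 < T.inradius * t / (y - 3) ∧
        T.inradius * (t + t) = T.inradius * t / (y - 3) * (2 * (y - 3)) ∧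
        T.inradius * (s + t) = T.inradius * t / (y - 3) * (y + 3) := by
      intro s t hs ht h1 h2 h3
      have h4 := isosceles_ratio hs ht (h1.trans h2.symm) h3 hy hyρ (h2 ▸ h0)
      refine ⟨by positivity, by field_simp; norm_num, ?_⟩
      field_simp
      linarith
    -- In each case the permutation sends `0` to the apex, the vertex whose tangent length is not
    -- one of the two equal ones.
    rcases heq h0 with h | h | h
    · subst h
      obtain ⟨hk, h1, h2⟩ := key w u hw hu (by linarith) (by linarith) (by linarith)
      refine ⟨finRotate 3 ^ 2, _, hk, ?_, ?_, ?_⟩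
      · exact hc.trans h1
      · refine Eq.trans ?_ h2
        exact ha.trans (by ring)
      · exact hb.trans h2
    · subst h
      obtain ⟨hk, h1, h2⟩ := key u v hu hv (by linarith) (by linarith) (by linarith)
      refine ⟨1, _, hk, ha.trans h1, ?_, hc.trans h2⟩
      exact Eq.trans (hb.trans (by ring)) h2
    · subst h
      obtain ⟨hk, h1, h2⟩ := key v w hv hw (by linarith) (by linarith) (by linarith)
      refine ⟨finRotate 3, _, hk, ?_, ?_, ?_⟩
      · exact hb.trans h1
      · refine Eq.trans ?_ h2
        exact hc.trans (by ring)
      · exact ha.trans h2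

lemma exists_hasSideRatio {x : ℝ} (hx : 3 ≤ x) :
    ∃ T : Tri, HasSideRatio T (2 * (x ^ 2 - 3)) (x ^ 2 + 3) (x ^ 2 + 3) := by
  have h3 : 0 < x ^ 2 - 3 := by nlinarith
  have hs3 := Real.sq_sqrt (show (0 : ℝ) ≤ 3 by norm_num)
  -- Base `2(x² - 3)` on the axis and height `2√3 x`, since `(x² - 3)² + 12x² = (x² + 3)²`.
  have hind : AffineIndependent ℝ
      ![(!₂[0, 2 * √3 * x] : EuclideanSpace ℝ (Fin 2)), !₂[-(x ^ 2 - 3), 0], !₂[x ^ 2 - 3, 0]] := by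
    rw [affineIndependent_iff_not_collinear_set,
      collinear_iff_of_mem (p₀ := !₂[-(x ^ 2 - 3), 0]) (by simp)]
    rintro ⟨v, hv⟩
    obtain ⟨s, hs⟩ := hv !₂[0, 2 * √3 * x] (by simp)
    obtain ⟨t, ht⟩ := hv !₂[x ^ 2 - 3, 0] (by simp)
    have hs1 := congrArg (fun p : EuclideanSpace ℝ (Fin 2) => p 1) hs
    have ht0 := congrArg (fun p : EuclideanSpace ℝ (Fin 2) => p 0) ht
    have ht1 := congrArg (fun p : EuclideanSpace ℝ (Fin 2) => p 1) ht
    simp at hs1 ht0 ht1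
    have hx0 : 0 < 2 * √3 * x := by positivity
    rcases ht1 with h | h
    · rw [h] at ht0
      linarith
    · rw [h] at hs1
      simp at hs1
      linarith
  have hside : √((x ^ 2 - 3) ^ 2 + (2 * √3 * x) ^ 2) = x ^ 2 + 3 := by
    rw [Real.sqrt_eq_iff_mul_self_eq_of_pos (by positivity)]
    linear_combination (-4) * x ^ 2 * hs3
  refine ⟨⟨_, hind⟩, 1, 1, one_pos, ?_, ?_, ?_⟩
  · simp [EuclideanSpace.dist_eq, Real.dist_eq]
    rw [show 3 - x ^ 2 - (x ^ 2 - 3) = -(2 * (x ^ 2 - 3)) by ring, neg_sq,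
      Real.sqrt_sq (by positivity)]
  · simp [EuclideanSpace.dist_eq, Real.dist_eq]
    exact hside
  · simp [EuclideanSpace.dist_eq, Real.dist_eq]
    simpa using hside

/-- For exponents up to the minimum of `f`, the isosceles triangles satisfy the inequality. -/
lemma le_rpow_add {x₀ x₁ : ℝ} (h₁ : 3 < x₁) (h₁₀ : x₁ < x₀)
    (hcubic : ∀ x, 3 ≤ x → x < x₀ → cubic x < 0) (hnonneg : ∀ x, x₀ ≤ x → 0 ≤ cubic x)
    (hf : ∀ x, 3 < x → x < x₀ → x ≠ x₁ → f x₁ < f x) {l x : ℝ} (hl : l ≤ f x₁) (hx : 3 ≤ x) :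
    10 - 2 * x ^ 3 / (x ^ 2 - 3) ≤ (24 * (x ^ 2 - 3) / (x ^ 2 + 3) ^ 2) ^ l ∧
      (10 - 2 * x ^ 3 / (x ^ 2 - 3) = (24 * (x ^ 2 - 3) / (x ^ 2 + 3) ^ 2) ^ l ↔
        x = 3 ∨ (l = f x₁ ∧ x = x₁)) := by
  rcases hx.eq_or_lt with rfl | h3
  -- At `x = 3` both sides equal `1` for every exponent.
  · norm_num
  · have hs : 0 < x ^ 2 - 3 := by nlinarith
    rcases le_or_gt x₀ x with h0 | h0
    · have hlt : 10 - 2 * x ^ 3 / (x ^ 2 - 3) < (24 * (x ^ 2 - 3) / (x ^ 2 + 3) ^ 2) ^ l := by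
        refine lt_of_le_of_lt ?_ (Real.rpow_pos_of_pos (by positivity) l)
        rw [sub_nonpos, le_div_iff₀ hs]
        have := hnonneg x h0
        simp only [cubic] at this
        linarith
      refine ⟨hlt.le, iff_of_false hlt.ne ?_⟩
      rintro (h | ⟨-, h⟩) <;> linarith
    · have hc := hcubic x hx h0
      have hle : f x₁ ≤ f x := by
        rcases eq_or_ne x x₁ with rfl | h
        · rfl
        · exact (hf x h3 h0 h).le
      have h1 := rpow_lt_iff (l := l) h3 hc
      have h2 := lt_rpow_iff (l := l) h3 hc
      refine ⟨not_lt.1 (h1.not.2 (by linarith)), ?_⟩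
      have heq : 10 - 2 * x ^ 3 / (x ^ 2 - 3) = (24 * (x ^ 2 - 3) / (x ^ 2 + 3) ^ 2) ^ l ↔
          l = f x := by
        constructor
        · intro h
          exact le_antisymm (by linarith) (not_lt.1 (h2.not.1 h.not_lt))
        · intro h
          exact le_antisymm (not_lt.1 (h1.not.2 h.not_gt)) (not_lt.1 (h2.not.2 h.not_lt))
      rw [heq]
      constructor
      · intro h
        rcases eq_or_ne x x₁ with rfl | hne
        · exact Or.inr ⟨h, rfl⟩
        · have := hf x h3 h0 hne
          linarith
      · rintro (h | ⟨h, rfl⟩)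
        · linarith
        · exact h

lemma hasSideRatio_three_iff (T : Tri) :
    HasSideRatio T (2 * (3 ^ 2 - 3)) (3 ^ 2 + 3) (3 ^ 2 + 3) ↔ HasSideRatio T 1 1 1 := by
  constructor
  · rintro ⟨σ, k, hk, h1, h2, h3⟩
    exact ⟨σ, k * 12, by positivity, by linarith, by linarith, by linarith⟩
  · rintro ⟨σ, k, hk, h1, h2, h3⟩
    exact ⟨σ, k / 12, by positivity, by linarith, by linarith, by linarith⟩

end EdwardsChild

end

theorem theorem1 :
    ∃ x₀ x₁ : ℝ,
      -- `x₀` is the largest real root of the cubic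
      IsGreatest {x : ℝ | x ^ 3 - 5 * x ^ 2 + 15 = 0} x₀ ∧
      |x₀ - 4.113537611| < 5e-10 ∧
      -- `x₁` is the only critical point of `f` in `(3, x₀)`
      3 < x₀ ∧
      DifferentiableOn ℝ EdwardsChild.f (Ioo 3 x₀) ∧
      (∀ x ∈ Ioo 3 x₀, deriv EdwardsChild.f x = 0 ↔ x = x₁) ∧
      x₁ ∈ Ioo 3 x₀ ∧
      |x₁ - 3.067873979| < 5e-10 ∧
      |EdwardsChild.f x₁ - 5.977929015| < 5e-10 ∧
      -- the inequality, with its cases of equality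
      (∀ l : ℝ, l ≤ EdwardsChild.f x₁ → ∀ T : EdwardsChild.Tri,
        Real.sqrt 3 * EdwardsChild.semiperimeter T ≥ EdwardsChild.lowerBound T l ∧
        (Real.sqrt 3 * EdwardsChild.semiperimeter T = EdwardsChild.lowerBound T l ↔
          EdwardsChild.HasSideRatio T 1 1 1 ∨
          (l = EdwardsChild.f x₁ ∧
            EdwardsChild.HasSideRatio T (2 * (x₁ ^ 2 - 3)) (x₁ ^ 2 + 3) (x₁ ^ 2 + 3)))) ∧
      -- the bound on the exponent is best possible
      (∀ l : ℝ, EdwardsChild.f x₁ < l → ∃ T : EdwardsChild.Tri,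
        Real.sqrt 3 * EdwardsChild.semiperimeter T < EdwardsChild.lowerBound T l) ∧
      -- the conjectured case of exponent `5`
      5 < EdwardsChild.f x₁ ∧
      (∀ T : EdwardsChild.Tri,
        Real.sqrt 3 * EdwardsChild.semiperimeter T ≥
          10 * T.inradius - T.inradius * (2 * T.inradius / T.circumradius) ^ 5) := by
  open EdwardsChild in
  obtain ⟨x₀, hgreat, hl₀, hr₀, hcubic, hnonneg⟩ := exists_isGreatest_cubic_root
  obtain ⟨x₁, hl₁, hr₁, hfx₁, hneg, hzero, hpos⟩ := exists_critical (by linarith) hcubic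
  have h₁ : 3 < x₁ := by linarith
  have h₁₀ : x₁ < x₀ := by linarith
  have hf : ∀ x, 3 < x → x < x₀ → x ≠ x₁ → f x₁ < f x :=
    fun x => f_critical_lt h₁ h₁₀ hcubic hneg hpos
  have hderiv : ∀ x ∈ Ioo 3 x₀, HasDerivAt f (2 * x * (9 - x ^ 2) / ((x ^ 2 - 3) * (x ^ 2 + 3)) *
      -critical x / logDen x ^ 2) x := fun x hx => hasDerivAt_f hx.1 (hcubic x hx.1.le hx.2)
  have hmain : ∀ l : ℝ, l ≤ f x₁ → ∀ T : Tri,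
      √3 * semiperimeter T ≥ lowerBound T l ∧
      (√3 * semiperimeter T = lowerBound T l ↔ HasSideRatio T 1 1 1 ∨
        (l = f x₁ ∧ HasSideRatio T (2 * (x₁ ^ 2 - 3)) (x₁ ^ 2 + 3) (x₁ ^ 2 + 3))) := by
    intro l hl T
    obtain ⟨x, hx, ht, hle, heq⟩ := exists_isosceles_comparison T
    have hr := T.inradius_pos
    obtain ⟨hle', heq'⟩ := le_rpow_add h₁ h₁₀ hcubic hnonneg hf hl hx
    have hbound : lowerBound T l ≤ T.inradius * (2 * x ^ 3 / (x ^ 2 - 3)) := by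
      rw [lowerBound, ht]
      nlinarith
    refine ⟨hbound.trans hle, fun h => ?_, ?_⟩
    · have h1 := heq (le_antisymm (h.trans_le hbound) hle)
      have h2 : T.inradius * (10 - 2 * x ^ 3 / (x ^ 2 - 3)) =
          T.inradius * (24 * (x ^ 2 - 3) / (x ^ 2 + 3) ^ 2) ^ l := by
        have h3 := le_antisymm hbound (hle.trans_eq h)
        rw [lowerBound, ht] at h3
        linarith
      rcases heq'.1 (mul_left_cancel₀ hr.ne' h2) with rfl | ⟨hl', rfl⟩
      · exact Or.inl ((hasSideRatio_three_iff T).1 h1)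
      · exact Or.inr ⟨hl', h1⟩
    -- For the converse, `p / r` and `R / r` are computed from the given side ratio itself, so the
    -- comparison parameter `x` plays no role.
    · have hconv : ∀ y, 3 ≤ y → (y = 3 ∨ (l = f x₁ ∧ y = x₁)) →
          HasSideRatio T (2 * (y ^ 2 - 3)) (y ^ 2 + 3) (y ^ 2 + 3) →
          √3 * semiperimeter T = lowerBound T l := by
        intro y hy hcase hT
        obtain ⟨h1, h2⟩ := hT.relations hy
        rw [h1, lowerBound, h2,
          ← (le_rpow_add h₁ h₁₀ hcubic hnonneg hf hl hy).2.2 hcase]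
        ring
      rintro (hT | ⟨hl', hT⟩)
      · exact hconv 3 le_rfl (Or.inl rfl) ((hasSideRatio_three_iff T).2 hT)
      · exact hconv x₁ h₁.le (Or.inr ⟨hl', rfl⟩) hT
  have h5 : 5 < f x₁ := by
    have := (abs_lt.1 hfx₁).1
    norm_num at this
    linarith
  refine ⟨x₀, x₁, hgreat, ?_, by linarith, fun x hx =>
    (hderiv x hx).differentiableAt.differentiableWithinAt, fun x hx => ?_, ⟨h₁, h₁₀⟩, ?_, hfx₁,
    hmain, fun l hl => ?_, h5, fun T => ?_⟩
  · rw [abs_lt]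
    constructor <;> norm_num <;> linarith
  · have hB := (logDen_neg hx.1).ne
    have h3 : x ^ 2 - 3 ≠ 0 := by nlinarith [hx.1]
    have h9 : 9 - x ^ 2 ≠ 0 := by nlinarith [hx.1]
    have hx0 : x ≠ 0 := by linarith [hx.1]
    have h3' : x ^ 2 + 3 ≠ 0 := by positivity
    rw [(hderiv x hx).deriv]
    constructor
    · intro h
      have hcrit : critical x = 0 := by
        simpa [hB, h3, h9, hx0, h3'] using h
      rcases lt_trichotomy x x₁ with h | h | h
      · exact absurd hcrit (hneg x hx.1 h).ne
      · exact h
      · exact absurd hcrit (hpos x h hx.2).ne'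
    · rintro rfl
      simp [hzero]
  · rw [abs_lt]
    constructor <;> norm_num <;> linarith
  -- The extremal triangle at `x₁` already violates the inequality for every larger exponent.
  · obtain ⟨T, hT⟩ := exists_hasSideRatio h₁.le
    refine ⟨T, ?_⟩
    obtain ⟨h1, h2⟩ := hT.relations h₁.le
    have h3 := (rpow_lt_iff h₁ (hcubic x₁ h₁.le h₁₀)).2 hl
    have hr := T.inradius_pos
    rw [h1, lowerBound, h2]
    nlinarith
  · have h := (hmain 5 h5.le T).1
    rw [lowerBound, show (5 : ℝ) = ((5 : ℕ) : ℝ) by norm_num, Real.rpow_natCast] at h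
    exact h
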